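/- Let $\Omega\subset\mathbb R^d$ be a bounded open set (for instance a bounded Lipschitz domain), and let $T,\varepsilon>0$, $C_A>0$, $C_\psi\ge 0$ and $c<1$. Write $(\cdot,\cdot)$ for the inner products of $L^2(\Omega)$ and $L^2(\Omega)^d$. Then there is a constant $C>0$, depending only on $\Omega,T,\varepsilon,C_A,C_\psi,c$, such that the following holds. Assumptions on $A$, $\psi$, $y_0$. Let $A\in C^1(\mathbb R^d)$ be such that $A'=\nabla A$ is strongly monotone and $|A'(p)|\le C_0|p|$ for all $p\in\mathbb R^d$, with some constant $C_0$. Let $\psi\in C^1(\mathbb R)$ be bounded from below and suppose that there are $f_n\in C^2(\mathbb R)$ with $f_n\to\psi$ in $C^1_{\rm loc}(\mathbb R)$, $-c_0\le f_n\le c_0(\psi+1)$, $f_n''\ge -C_\psi$ and $|f_n''|\le C_n$, with constants $c_0,C_n\ge0$. Let $y_0\in H^1(\Omega)$ with $\psi(y_0)\in L^1(\Omega)$. Assumptions on the regularizations. Let $(A_\delta)_{\delta\in D}$ be a family in $C^1(\mathbb R^d)$ such that for all $\delta\in D$ and all $p,q\in\mathbb R^d$ $$(A_\delta'(p)-A_\delta'(q))\cdot(p-q)\ge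 C_A|p-q|^2,\qquad |A_\delta'(p)-A'(p)|\le\eta(\delta).$$ Time grid. Let $0=t_0<t_1<\dots<t_N=T$, $\tau_j=t_j-t_{j-1}$, $I_j=(t_{j-1},t_j]$, with $$\frac{C_\psi}{\varepsilon^2}\max_j\tau_j\le c .$$ Let $u_\tau$ be a control that is constant in time on each $I_j$, with value $u_j\in L^2(\Omega)$, and let $\delta\in D$. Let $y_\tau$ and $y_\tau^\delta$ be constant in time on each $I_j$, with values $y_j,y_j^\delta\in H^1(\Omega)$, and let them solve, with $y_\tau(0)=y^\delta_\tau(0)=y_0$ (and $y_0^\delta:=y_0$), for $j=1,\dots,N$ and all $\varphi\in H^1(\Omega)$, $$\tfrac{\varepsilon}{\tau_j}(y_j,\varphi)+\varepsilon(A'(\nabla y_j),\nabla\varphi)+\tfrac1\varepsilon(\psi'(y_j),\varphi)=(u_j,\varphi)+\tfrac{\varepsilon}{\tau_j}(y_{j-1},\varphi),$$ $$\tfrac{\varepsilon}{\tau_j}(y^\delta_j,\varphi)+\varepsilon(A_\delta'(\nabla y^\delta_j),\nabla\varphi)+\tfrac1\varepsilon(\psi'(y^\delta_j),\varphi)=(u_j,\varphi)+\tfrac{\varepsilon}{\tau_j}(y^\delta_{j-1},\varphi),$$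 where $\psi'(y_j)\varphi$ and $\psi'(y_j^\delta)\varphi$ are integrable for all $\varphi\in H^1(\Omega)$. Then $$\|y_\tau-y_\tau^\delta\|_{L^\infty(0,T;L^2(\Omega))}+\|\nabla y_\tau-\nabla y_\tau^\delta\|_{L^2(0,T;L^2(\Omega))}\le C\,\eta(\delta).$$ -/

import Mathlib

open MeasureTheory Filter Topology Set
open scoped ENNReal ContDiff

namespace AllenCahn

/-- Euclidean space `ℝ^d`. -/
abbrev E (d : ℕ) : Type := EuclideanSpace ℝ (Fin d)

/-- The Lebesgue space `L²(Ω)` of real functions (classes modulo null sets). -/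
abbrev L2 {d : ℕ} (Ω : Set (E d)) : Type := Lp ℝ 2 (volume.restrict Ω)

/-- The Lebesgue space `L²(Ω)^d` of vector fields. -/
abbrev L2Vec {d : ℕ} (Ω : Set (E d)) : Type := Lp (E d) 2 (volume.restrict Ω)

/-- Test functions: smooth functions with compact support inside `Ω`. -/
structure IsTestFunction {d : ℕ} (Ω : Set (E d)) (φ : E d → ℝ) : Prop where
  smooth : ContDiff ℝ ∞ φ
  compact_support : HasCompactSupport φ
  support_subset : tsupport φ ⊆ Ω

/-- `g` is the weak gradient of `f` in `Ω`: `∫_Ω f ∇φ = - ∫_Ω φ g` for all test functions `φ`. -/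
def IsWeakGradient {d : ℕ} (Ω : Set (E d)) (f : E d → ℝ) (g : E d → E d) : Prop :=
  ∀ φ : E d → ℝ, IsTestFunction Ω φ →
    ∫ x in Ω, f x • gradient φ x = - ∫ x in Ω, φ x • g x

theorem IsTestFunction.memLp {d : ℕ} {Ω : Set (E d)} {φ : E d → ℝ} (h : IsTestFunction Ω φ) :
    MemLp φ 2 (volume.restrict Ω) :=
  h.smooth.continuous.memLp_of_hasCompactSupport h.compact_support

theorem IsTestFunction.memLp_gradient {d : ℕ} {Ω : Set (E d)} {φ : E d → ℝ}
    (h : IsTestFunction Ω φ) : MemLp (gradient φ) 2 (volume.restrict Ω) := by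
  have hc : Continuous (gradient φ) :=
    (InnerProductSpace.toDual ℝ (E d)).symm.continuous.comp
      (h.smooth.continuous_fderiv (by simp))
  have hs : HasCompactSupport (gradient φ) :=
    (h.compact_support.fderiv (𝕜 := ℝ)).comp_left (map_zero _)
  exact hc.memLp_of_hasCompactSupport hs

theorem integrable_smul_of_L2 {d : ℕ} {μ : Measure (E d)} {f : E d → ℝ} {g : E d → E d}
    (hf : MemLp f 2 μ) (hg : MemLp g 2 μ) : Integrable (fun x => f x • g x) μ :=
  memLp_one_iff_integrable.1 (hg.smul hf)

/-- The Sobolev space `H¹(Ω) = W^{1,2}(Ω)`: the pairs `(f, ∇f)` of an `L²(Ω)` function `f` and a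
weak gradient of `f` in `L²(Ω)^d`. (For open `Ω` the second entry is determined by the first.) -/
def H1 {d : ℕ} (Ω : Set (E d)) : Submodule ℝ (L2 Ω × L2Vec Ω) where
  carrier := {w | IsWeakGradient Ω w.1 w.2}
  zero_mem' := by
    intro φ hφ
    have h1 : ∫ x in Ω, ((0 : L2 Ω) : E d → ℝ) x • gradient φ x = 0 := by
      refine integral_eq_zero_of_ae ?_
      filter_upwards [Lp.coeFn_zero ℝ 2 (volume.restrict Ω)] with x hx
      rw [hx]; exact zero_smul ℝ _
    have h2 : ∫ x in Ω, φ x • ((0 : L2Vec Ω) : E d → E d) x = 0 := by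
      refine integral_eq_zero_of_ae ?_
      filter_upwards [Lp.coeFn_zero (E d) 2 (volume.restrict Ω)] with x hx
      rw [hx]; exact smul_zero _
    change ∫ x in Ω, ((0 : L2 Ω) : E d → ℝ) x • gradient φ x
      = - ∫ x in Ω, φ x • ((0 : L2Vec Ω) : E d → E d) x
    rw [h1, h2, neg_zero]
  add_mem' := by
    intro a b ha hb φ hφ
    have h1 : ∫ x in Ω, ((a.1 + b.1 : L2 Ω) : E d → ℝ) x • gradient φ x
        = (∫ x in Ω, (a.1 : E d → ℝ) x • gradient φ x)
          + ∫ x in Ω, (b.1 : E d → ℝ) x • gradient φ x := by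
      rw [← integral_add (integrable_smul_of_L2 (Lp.memLp a.1) hφ.memLp_gradient)
        (integrable_smul_of_L2 (Lp.memLp b.1) hφ.memLp_gradient)]
      refine integral_congr_ae ?_
      filter_upwards [Lp.coeFn_add a.1 b.1] with x hx
      rw [hx]; exact add_smul _ _ _
    have h2 : ∫ x in Ω, φ x • ((a.2 + b.2 : L2Vec Ω) : E d → E d) x
        = (∫ x in Ω, φ x • (a.2 : E d → E d) x) + ∫ x in Ω, φ x • (b.2 : E d → E d) x := by
      rw [← integral_add (integrable_smul_of_L2 hφ.memLp (Lp.memLp a.2))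
        (integrable_smul_of_L2 hφ.memLp (Lp.memLp b.2))]
      refine integral_congr_ae ?_
      filter_upwards [Lp.coeFn_add a.2 b.2] with x hx
      rw [hx]; exact smul_add _ _ _
    change ∫ x in Ω, ((a.1 + b.1 : L2 Ω) : E d → ℝ) x • gradient φ x
      = - ∫ x in Ω, φ x • ((a.2 + b.2 : L2Vec Ω) : E d → E d) x
    rw [h1, h2, ha φ hφ, hb φ hφ, neg_add]
  smul_mem' := by
    intro r a ha φ hφ
    have h1 : ∫ x in Ω, ((r • a.1 : L2 Ω) : E d → ℝ) x • gradient φ x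
        = r • ∫ x in Ω, (a.1 : E d → ℝ) x • gradient φ x := by
      rw [← integral_smul]
      refine integral_congr_ae ?_
      filter_upwards [Lp.coeFn_smul r a.1] with x hx
      rw [hx]; exact mul_smul r _ _
    have h2 : ∫ x in Ω, φ x • ((r • a.2 : L2Vec Ω) : E d → E d) x
        = r • ∫ x in Ω, φ x • (a.2 : E d → E d) x := by
      rw [← integral_smul]
      refine integral_congr_ae ?_
      filter_upwards [Lp.coeFn_smul r a.2] with x hx
      rw [hx]
      exact smul_comm (φ x) r ((a.2 : E d → E d) x)
    change ∫ x in Ω, ((r • a.1 : L2 Ω) : E d → ℝ) x • gradient φ x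
      = - ∫ x in Ω, φ x • ((r • a.2 : L2Vec Ω) : E d → E d) x
    rw [h1, h2, ha φ hφ, smul_neg]

/-- The underlying `L²(Ω)` function of an `H¹(Ω)` function. -/
def fn {d : ℕ} {Ω : Set (E d)} (w : H1 Ω) : L2 Ω := w.1.1

/-- The weak gradient of an `H¹(Ω)` function. -/
def wgrad {d : ℕ} {Ω : Set (E d)} (w : H1 Ω) : L2Vec Ω := w.1.2

/-- A vector field on `ℝ^d` is strongly monotone with constant `c`. -/
def StronglyMonotoneWith {d : ℕ} (c : ℝ) (F : E d → E d) : Prop :=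
  ∀ p q : E d, c * ‖p - q‖ ^ 2 ≤ inner ℝ (F p - F q) (p - q)

/-- Assumption on `A`: it is `C¹`, and `A'` is strongly monotone with `|A'(p)| ≤ C |p|`. -/
structure AnisotropyAssumption {d : ℕ} (A : E d → ℝ) : Prop where
  contDiff : ContDiff ℝ 1 A
  strongly_monotone : ∃ c : ℝ, 0 < c ∧ StronglyMonotoneWith c (gradient A)
  growth : ∃ C : ℝ, ∀ p : E d, ‖gradient A p‖ ≤ C * ‖p‖

/-- Assumption on `ψ` with the constant `Cψ`: it is `C¹`, bounded from below, and the limit in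
`C¹_loc` of `C²` functions `f_n` with `-c ≤ f_n ≤ c (ψ + 1)`, `f_n'' ≥ -Cψ`, `|f_n''| ≤ C_n`. -/
structure PotentialAssumption (ψ : ℝ → ℝ) (Cψ : ℝ) : Prop where
  contDiff : ContDiff ℝ 1 ψ
  bddBelow : BddBelow (range ψ)
  nonneg : 0 ≤ Cψ
  approx : ∃ (f : ℕ → ℝ → ℝ) (c : ℝ), 0 ≤ c ∧
    (∀ n, ContDiff ℝ 2 (f n)) ∧
    TendstoLocallyUniformly f ψ atTop ∧
    TendstoLocallyUniformly (fun n => deriv (f n)) (deriv ψ) atTop ∧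
    (∀ n s, -c ≤ f n s ∧ f n s ≤ c * (ψ s + 1)) ∧
    (∀ n s, -Cψ ≤ deriv (deriv (f n)) s) ∧
    (∀ n, ∃ Cn : ℝ, ∀ s, |deriv (deriv (f n)) s| ≤ Cn)

/-- `0 = t_0 < t_1 < ⋯ < t_N = T`. -/
structure IsTimeGrid (T : ℝ) (N : ℕ) (t : Fin (N + 1) → ℝ) : Prop where
  strictMono : StrictMono t
  first : t 0 = 0
  last : t (Fin.last N) = T

/-- The step size `τ_j = t_j - t_{j-1}` of the interval `I_j = (t_{j-1}, t_j]`; here and below the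
intervals are indexed by `j : Fin N`, with end points `t j.castSucc` and `t j.succ`. -/
def stepSize {N : ℕ} (t : Fin (N + 1) → ℝ) (j : Fin N) : ℝ := t j.succ - t j.castSucc

/-- A time dependent function is constant on each interval `I_j = (t_{j-1}, t_j]`; its constant
value there is the value at `t_j`. With `X = H¹(Ω)` and `X = L²(Ω)` these are the spaces of
discrete states and of discrete controls. -/
def IsPiecewiseConst {X : Type*} {N : ℕ} (t : Fin (N + 1) → ℝ) (v : ℝ → X) : Prop :=
  ∀ j : Fin N, ∀ s ∈ Ioc (t j.castSucc) (t j.succ), v s = v (t j.succ)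

/-- `y` is a discrete state for the control `u`, that is a piecewise constant function with values
in `H¹(Ω)`, `y(0) = y₀`, such that in each time step and for all `φ ∈ H¹(Ω)`
`ε/τ_j (y_j, φ) + ε (A'(∇y_j), ∇φ) + 1/ε (ψ'(y_j), φ) = (u_j, φ) + ε/τ_j (y_{j-1}, φ)`.
The integrability clause gives `(ψ'(y_j), φ)` a meaning. -/
structure IsDiscreteState {d : ℕ} (Ω : Set (E d)) (ε : ℝ) (A : E d → ℝ) (ψ : ℝ → ℝ)
    {N : ℕ} (t : Fin (N + 1) → ℝ) (y₀ : H1 Ω) (u : ℝ → L2 Ω) (y : ℝ → H1 Ω) : Prop where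
  piecewise_const : IsPiecewiseConst t y
  initial : y 0 = y₀
  integrable : ∀ j : Fin N, ∀ φ : H1 Ω,
    IntegrableOn (fun x => deriv ψ (fn (y (t j.succ)) x) * fn φ x) Ω
  equation : ∀ j : Fin N, ∀ φ : H1 Ω,
    ε / stepSize t j * inner ℝ (fn (y (t j.succ))) (fn φ)
      + ε * (∫ x in Ω, inner ℝ (gradient A (wgrad (y (t j.succ)) x)) (wgrad φ x))
      + 1 / ε * (∫ x in Ω, deriv ψ (fn (y (t j.succ)) x) * fn φ x)
    = inner ℝ (u (t j.succ)) (fn φ)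
      + ε / stepSize t j * inner ℝ (fn (y (t j.castSucc))) (fn φ)

end AllenCahn

namespace AllenCahn

/-! Subtract the two schemes and test with the error `e_j = y_j - y_j^δ`; the control cancels.
Strong monotonicity of `A_δ'` and Young's inequality bound the anisotropy term below by `C_A/2
‖∇e_j‖² - η² |Ω| / (2 C_A)` (`integral_inner_gradient_ge`). Since `ψ'` is monotone up to the linear
term `Cψ s`, the potential term is at least `-Cψ ‖e_j‖²` (`integral_deriv_mul_ge`).

The step size condition keeps `1 - Cψ τ_j / ε² ≥ 1 - c > 0`, so this loss costs only an exponential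
factor per step (`step_estimate`). As `e_0 = 0`, the discrete Gronwall inequality leaves only the
source terms of order `η²`; square roots give the linear rate. -/

theorem fn_sub {d : ℕ} {Ω : Set (E d)} (v w : H1 Ω) : fn (v - w) = fn v - fn w := rfl

theorem wgrad_sub {d : ℕ} {Ω : Set (E d)} (v w : H1 Ω) : wgrad (v - w) = wgrad v - wgrad w := rfl

theorem continuous_gradient {d : ℕ} {A : E d → ℝ} (hA : ContDiff ℝ 1 A) :
    Continuous (gradient A) :=
  (InnerProductSpace.toDual ℝ (E d)).symm.continuous.comp (hA.continuous_fderiv (by simp))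

/-- The derivative of the potential satisfies a one-sided Lipschitz condition. -/
theorem PotentialAssumption.deriv_sub_mul_sub_ge {ψ : ℝ → ℝ} {Cψ : ℝ}
    (h : PotentialAssumption ψ Cψ) (a b : ℝ) :
    -Cψ * (a - b) ^ 2 ≤ (deriv ψ a - deriv ψ b) * (a - b) := by
  obtain ⟨f, c, -, hf, -, hf', -, hf'', -⟩ := h.approx
  have key : ∀ n, -Cψ * (a - b) ^ 2 ≤ (deriv (f n) a - deriv (f n) b) * (a - b) := by
    intro n
    have hd : Differentiable ℝ (deriv (f n)) :=
      ((contDiff_succ_iff_deriv (n := 1)).1 (hf n)).2.2.differentiable (by simp)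
    -- `ψ` need not be twice differentiable, so the bound on the second derivative is used for `f
    -- n`; the resulting inequality survives pointwise limits.
    have hmono : Monotone fun s => deriv (f n) s + Cψ * s := by
      refine monotone_of_deriv_nonneg (by fun_prop) fun s => ?_
      have hs : HasDerivAt (fun s => deriv (f n) s + Cψ * s)
          (deriv (deriv (f n)) s + Cψ * 1) s :=
        (hd s).hasDerivAt.add ((hasDerivAt_id s).const_mul Cψ)
      rw [hs.deriv]
      linarith [hf'' n s]
    rcases le_total a b with hab | hab
    · have := hmono hab
      simp only at this
      nlinarith
    · have := hmono hab
      simp only at this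
      nlinarith
  have ha := (tendstoLocallyUniformlyOn_univ.2 hf').tendsto_at (mem_univ a)
  have hb := (tendstoLocallyUniformlyOn_univ.2 hf').tendsto_at (mem_univ b)
  exact ge_of_tendsto' ((ha.sub hb).mul_const (a - b)) key

/-! ### Lower bounds for the two nonlinear terms -/

/-- The offset `b` is needed for the regularized field, whose growth is only known up to the
additive error `η`; constants are square integrable because the measure is finite. -/
theorem memLp_gradient_comp {d : ℕ} {μ : Measure (E d)} [IsFiniteMeasure μ] {A : E d → ℝ}
    (hA : ContDiff ℝ 1 A) {C b : ℝ} (hC : ∀ p, ‖gradient A p‖ ≤ C * ‖p‖ + b) {g : E d → E d}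
    (hg : MemLp g 2 μ) : MemLp (fun x => gradient A (g x)) 2 μ := by
  refine MemLp.of_le ((hg.norm.const_mul C).add (memLp_const b))
    ((continuous_gradient hA).comp_aestronglyMeasurable hg.1) (Eventually.of_forall fun x => ?_)
  exact (hC (g x)).trans (Real.le_norm_self _)

theorem integrable_inner_of_memLp {d : ℕ} {μ : Measure (E d)} {f g : E d → E d}
    (hf : MemLp f 2 μ) (hg : MemLp g 2 μ) : Integrable (fun x => (inner ℝ (f x) (g x) : ℝ)) μ := by
  have h := L2.integrable_inner (𝕜 := ℝ) (hf.toLp f) (hg.toLp g)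
  refine h.congr ?_
  filter_upwards [hf.coeFn_toLp, hg.coeFn_toLp] with x h1 h2
  rw [h1, h2]

/-- Perturbing a strongly monotone field by at most `η` costs a quadratic error. -/
theorem StronglyMonotoneWith.inner_sub_ge {d : ℕ} {c η : ℝ} (hc : 0 < c) {F G : E d → E d}
    (hG : StronglyMonotoneWith c G) (hFG : ∀ p, ‖G p - F p‖ ≤ η) (p q : E d) :
    c / 2 * ‖p - q‖ ^ 2 - η ^ 2 / (2 * c) ≤ inner ℝ (F p - G q) (p - q) := by
  have h1 := hG p q
  have h2 : inner ℝ (G p - F p) (p - q) ≤ η * ‖p - q‖ :=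
    (real_inner_le_norm _ _).trans (mul_le_mul_of_nonneg_right (hFG p) (norm_nonneg _))
  -- Inserting `G p` separates the monotone part from the perturbation; half of the monotonicity
  -- constant then absorbs the perturbation.
  have h3 : inner ℝ (F p - G q) (p - q)
      = inner ℝ (G p - G q) (p - q) - inner ℝ (G p - F p) (p - q) := by
    rw [← inner_sub_left]; congr 1; abel
  have h4 : η * ‖p - q‖ ≤ c / 2 * ‖p - q‖ ^ 2 + η ^ 2 / (2 * c) := by
    have : c / 2 * ‖p - q‖ ^ 2 + η ^ 2 / (2 * c) - η * ‖p - q‖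
        = (c * ‖p - q‖ - η) ^ 2 / (2 * c) := by field_simp; ring
    have : 0 ≤ (c * ‖p - q‖ - η) ^ 2 / (2 * c) := by positivity
    linarith
  rw [h3]; linarith

theorem integral_inner_gradient_ge {d : ℕ} {Ω : Set (E d)} [IsFiniteMeasure (volume.restrict Ω)]
    {A B : E d → ℝ} (hA : AnisotropyAssumption A) (hB : ContDiff ℝ 1 B) {c η : ℝ} (hc : 0 < c)
    (hmono : StronglyMonotoneWith c (gradient B))
    (hAB : ∀ p, ‖gradient B p - gradient A p‖ ≤ η) (v w : H1 Ω) :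
    c / 2 * ‖wgrad (v - w)‖ ^ 2 - η ^ 2 / (2 * c) * (volume.restrict Ω).real univ ≤
      (∫ x in Ω, inner ℝ (gradient A (wgrad v x)) (wgrad (v - w) x))
        - ∫ x in Ω, inner ℝ (gradient B (wgrad w x)) (wgrad (v - w) x) := by
  obtain ⟨C, hC⟩ := hA.growth
  have hB' : ∀ p, ‖gradient B p‖ ≤ C * ‖p‖ + η := fun p => by
    have := norm_add_le (gradient A p) (gradient B p - gradient A p)
    rw [add_sub_cancel] at this
    linarith [hC p, hAB p]
  have hI1 := integrable_inner_of_memLp (memLp_gradient_comp hA.contDiff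
    (b := 0) (fun p => by simpa using hC p) (Lp.memLp (wgrad v))) (Lp.memLp (wgrad (v - w)))
  have hI2 := integrable_inner_of_memLp (memLp_gradient_comp hB hB' (Lp.memLp (wgrad w)))
    (Lp.memLp (wgrad (v - w)))
  have hI3 : Integrable (fun x => inner ℝ (wgrad (v - w) x) (wgrad (v - w) x))
    (volume.restrict Ω) := L2.integrable_inner (𝕜 := ℝ) _ _
  have hn : ‖wgrad (v - w)‖ ^ 2 = ∫ x in Ω, inner ℝ (wgrad (v - w) x) (wgrad (v - w) x) := by
    rw [← real_inner_self_eq_norm_sq, L2.inner_def]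
  have hconst : η ^ 2 / (2 * c) * (volume.restrict Ω).real univ
      = ∫ _ in Ω, η ^ 2 / (2 * c) := by
    rw [integral_const, smul_eq_mul, mul_comm]
  rw [hn, hconst, ← integral_const_mul, ← integral_sub (hI3.const_mul _) (integrable_const _),
    ← integral_sub hI1 hI2]
  refine integral_mono_ae ((hI3.const_mul _).sub (integrable_const _)) (hI1.sub hI2) ?_
  have hsub := Lp.coeFn_sub (wgrad v) (wgrad w)
  rw [← wgrad_sub] at hsub
  filter_upwards [hsub] with x hx
  simp only [Pi.sub_apply] at hx
  rw [← inner_sub_left, hx, real_inner_self_eq_norm_sq]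
  exact hmono.inner_sub_ge hc hAB _ _

theorem integral_deriv_mul_ge {d : ℕ} {Ω : Set (E d)} {ψ : ℝ → ℝ} {Cψ : ℝ}
    (hψ : PotentialAssumption ψ Cψ) {v w : H1 Ω}
    (hv : IntegrableOn (fun x => deriv ψ (fn v x) * fn (v - w) x) Ω)
    (hw : IntegrableOn (fun x => deriv ψ (fn w x) * fn (v - w) x) Ω) :
    -Cψ * ‖fn (v - w)‖ ^ 2 ≤ (∫ x in Ω, deriv ψ (fn v x) * fn (v - w) x)
        - ∫ x in Ω, deriv ψ (fn w x) * fn (v - w) x := by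
  have hI : Integrable (fun x => inner ℝ (fn (v - w) x) (fn (v - w) x))
    (volume.restrict Ω) := L2.integrable_inner (𝕜 := ℝ) _ _
  rw [← real_inner_self_eq_norm_sq, L2.inner_def, ← integral_const_mul, ← integral_sub hv hw]
  refine integral_mono_ae (hI.const_mul _) (hv.sub hw) ?_
  have hsub := Lp.coeFn_sub (fn v) (fn w)
  rw [← fn_sub] at hsub
  filter_upwards [hsub] with x hx
  simp only [Pi.sub_apply] at hx
  rw [real_inner_self_eq_norm_sq, Real.norm_eq_abs, sq_abs, hx, ← sub_mul]
  exact hψ.deriv_sub_mul_sub_ge _ _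

/-! ### One time step and discrete Gronwall -/

/-- The energy inequality of one implicit time step, in terms of norms. -/
theorem step_estimate {ε τ Cψ c C_A x z s g G P R : ℝ} (hε : 0 < ε) (hτ : 0 < τ) (hCψ : 0 ≤ Cψ)
    (hC_A : 0 < C_A) (hg : 0 ≤ g) (hR : 0 ≤ R) (hc : c < 1) (hstep : Cψ / ε ^ 2 * τ ≤ c)
    (hs : s ≤ x * z) (hG : C_A / 2 * g - R / 2 ≤ G) (hP : -Cψ * x ^ 2 ≤ P)
    (heq : ε / τ * (x ^ 2 - s) + ε * G + 1 / ε * P = 0) :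
    x ^ 2 + τ * (C_A * g) ≤
      Real.exp (2 * (Cψ / ε ^ 2 / (1 - c)) * τ) * (z ^ 2 + τ * R) := by
  set κ := Cψ / ε ^ 2 with hκ
  have hκ0 : 0 ≤ κ := by positivity
  have hκτ : 0 ≤ κ * τ := by positivity
  have hc' : 0 < 1 - c := by linarith
  set K := κ / (1 - c) with hK
  set θ := 1 - κ * τ with hθ
  have hθ0 : 0 < θ := by linarith
  have hθ1 : θ ≤ 1 := by linarith
  have h1 : x ^ 2 - s + τ * G + τ / ε ^ 2 * P = 0 := by
    have : x ^ 2 - s + τ * G + τ / ε ^ 2 * P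
        = τ / ε * (ε / τ * (x ^ 2 - s) + ε * G + 1 / ε * P) := by field_simp
    rw [this, heq, mul_zero]
  have h2 : -(κ * τ) * x ^ 2 ≤ τ / ε ^ 2 * P := by
    have h := mul_le_mul_of_nonneg_left hP (by positivity : 0 ≤ τ / ε ^ 2)
    have e : τ / ε ^ 2 * (-Cψ * x ^ 2) = -(κ * τ) * x ^ 2 := by rw [hκ]; ring
    linarith
  have h3 : τ * (C_A / 2 * g - R / 2) ≤ τ * G := mul_le_mul_of_nonneg_left hG hτ.le
  have h4 : θ * x ^ 2 + τ * (C_A * g) / 2 ≤ x * z + τ * R / 2 := by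
    have : θ * x ^ 2 = x ^ 2 - κ * τ * x ^ 2 := by rw [hθ]; ring
    linarith
  -- Multiplying by `2θ` before using `2θxz ≤ θ²x² + z²` leaves `z²` with coefficient exactly 1, as
  -- the recursion requires.
  have h5 : θ ^ 2 * x ^ 2 + θ * (τ * (C_A * g)) ≤ z ^ 2 + θ * (τ * R) := by
    have := mul_le_mul_of_nonneg_left h4 hθ0.le
    nlinarith [sq_nonneg (θ * x - z)]
  have hgg : 0 ≤ τ * (C_A * g) := by positivity
  have hRR : 0 ≤ τ * R := by positivity
  have h6 : θ ^ 2 * (x ^ 2 + τ * (C_A * g)) ≤ z ^ 2 + τ * R := by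
    have e1 : θ ^ 2 * (τ * (C_A * g)) ≤ θ * (τ * (C_A * g)) :=
      mul_le_mul_of_nonneg_right (by nlinarith) hgg
    have e2 : θ * (τ * R) ≤ τ * R := mul_le_of_le_one_left hRR hθ1
    linarith
  -- `1/θ ≤ 1 + Kτ` is where `κτ ≤ c < 1` enters. The bound is squared below, hence the factor 2 in
  -- the exponent.
  have h7 : 1 ≤ Real.exp (K * τ) * θ := by
    have e1 : 1 + K * τ ≤ Real.exp (K * τ) := by linarith [Real.add_one_le_exp (K * τ)]
    have e2 : 1 ≤ (1 + K * τ) * θ := by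
      have : (1 + K * τ) * θ - 1 = κ * τ * (c - κ * τ) / (1 - c) := by
        rw [hK, hθ]; field_simp; ring
      have : 0 ≤ κ * τ * (c - κ * τ) / (1 - c) :=
        div_nonneg (mul_nonneg hκτ (by linarith)) hc'.le
      linarith
    exact e2.trans (mul_le_mul_of_nonneg_right e1 hθ0.le)
  have h8 : Real.exp (2 * K * τ) = Real.exp (K * τ) ^ 2 := by
    rw [← Real.exp_nat_mul]; congr 1; push_cast; ring
  rw [h8]
  have h9 : 1 ≤ (Real.exp (K * τ) * θ) ^ 2 := one_le_pow₀ h7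
  have h10 : 0 ≤ x ^ 2 + τ * (C_A * g) := by positivity
  calc x ^ 2 + τ * (C_A * g) ≤ (Real.exp (K * τ) * θ) ^ 2 * (x ^ 2 + τ * (C_A * g)) :=
        le_mul_of_one_le_left h10 h9
    _ = Real.exp (K * τ) ^ 2 * (θ ^ 2 * (x ^ 2 + τ * (C_A * g))) := by ring
    _ ≤ _ := mul_le_mul_of_nonneg_left h6 (by positivity)

theorem add_sum_le_of_step {N : ℕ} {b t : Fin (N + 1) → ℝ} {G : Fin N → ℝ} {R : ℝ}
    (h : ∀ j : Fin N, b j.succ + G j ≤ b j.castSucc + (t j.succ - t j.castSucc) * R) :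
    b (Fin.last N) + ∑ j, G j ≤ b 0 + (t (Fin.last N) - t 0) * R := by
  induction N with
  | zero => simp
  | succ n ih =>
    have h1 := ih (b := fun i => b i.castSucc) (t := fun i => t i.castSucc)
      (G := fun j => G j.castSucc) fun j => by simpa using h j.castSucc
    have h2 := h (Fin.last n)
    rw [Fin.sum_univ_castSucc]
    simp only [Fin.castSucc_zero, Fin.succ_last] at h1 h2
    nlinarith

/-- A discrete Gronwall inequality on a time grid. -/
theorem discrete_gronwall {T K R : ℝ} {N : ℕ} {t : Fin (N + 1) → ℝ} (ht : IsTimeGrid T N t)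
    (hK : 0 ≤ K) (hR : 0 ≤ R) {a : Fin (N + 1) → ℝ} {g : Fin N → ℝ} (ha : ∀ i, 0 ≤ a i)
    (hg : ∀ j, 0 ≤ g j) (ha0 : a 0 = 0)
    (h : ∀ j : Fin N, a j.succ + stepSize t j * g j ≤
      Real.exp (K * stepSize t j) * (a j.castSucc + stepSize t j * R)) :
    (∀ i, a i ≤ Real.exp (K * T) * (T * R)) ∧
      ∑ j, stepSize t j * g j ≤ Real.exp (K * T) * (T * R) := by
  have ht0 : ∀ i, 0 ≤ t i := fun i => ht.first ▸ ht.strictMono.monotone (Fin.zero_le i)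
  have htT : ∀ i, t i ≤ T := fun i => ht.last ▸ ht.strictMono.monotone (Fin.le_last i)
  have hτ : ∀ j : Fin N, 0 < stepSize t j := fun j =>
    sub_pos.2 (ht.strictMono (Fin.castSucc_lt_succ (i := j)))
  have hle : ∀ i {x y : ℝ}, 0 ≤ x → Real.exp (-(K * t i)) * x ≤ y → x ≤ Real.exp (K * T) * y := by
    intro i x y hx hxy
    have e1 : Real.exp (-(K * T)) ≤ Real.exp (-(K * t i)) :=
      Real.exp_le_exp.2 (neg_le_neg (mul_le_mul_of_nonneg_left (htT i) hK))
    calc x = Real.exp (K * T) * (Real.exp (-(K * T)) * x) := by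
          rw [← mul_assoc, ← Real.exp_add]; simp
      _ ≤ Real.exp (K * T) * y := by
          gcongr
          exact (mul_le_mul_of_nonneg_right e1 hx).trans hxy
  -- The weight `exp(-K t_j)` is an integrating factor: it makes the recursion telescope, and being
  -- at most 1 it does not enlarge the source.
  have hstep : ∀ j : Fin N, Real.exp (-(K * t j.succ)) * a j.succ
      + Real.exp (-(K * t j.succ)) * (stepSize t j * g j) ≤
      Real.exp (-(K * t j.castSucc)) * a j.castSucc + (t j.succ - t j.castSucc) * R := by
    intro j
    have h1 := mul_le_mul_of_nonneg_left (h j) (Real.exp_pos (-(K * t j.succ))).le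
    rw [← mul_assoc, ← Real.exp_add,
      show -(K * t j.succ) + K * stepSize t j = -(K * t j.castSucc) by
        rw [stepSize]; ring] at h1
    have h2 : Real.exp (-(K * t j.castSucc)) * (stepSize t j * R) ≤ stepSize t j * R :=
      mul_le_of_le_one_left (mul_nonneg (hτ j).le hR)
        (Real.exp_le_one_iff.2 (neg_nonpos.2 (mul_nonneg hK (ht0 _))))
    change _ ≤ _ + stepSize t j * R
    linarith
  constructor
  · intro i
    -- The induction needs the sharper bound `t i * R` in place of `T * R`.
    refine hle i (ha i) (le_trans ?_ (mul_le_mul_of_nonneg_right (htT i) hR))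
    induction i using Fin.induction with
    | zero => rw [ha0, ht.first]; simp
    | succ j ih =>
      have h1 := hstep j
      have h2 : 0 ≤ Real.exp (-(K * t j.succ)) * (stepSize t j * g j) :=
        mul_nonneg (Real.exp_pos _).le (mul_nonneg (hτ j).le (hg j))
      linarith
  · refine hle (Fin.last N) (Finset.sum_nonneg fun j _ => mul_nonneg (hτ j).le (hg j)) ?_
    have h1 := add_sum_le_of_step (b := fun i => Real.exp (-(K * t i)) * a i) hstep
    simp only [ha0, ht.first, ht.last, mul_zero, zero_add, sub_zero] at h1
    have h2 : 0 ≤ Real.exp (-(K * T)) * a (Fin.last N) := mul_nonneg (Real.exp_pos _).le (ha _)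
    rw [Finset.mul_sum]
    refine le_trans (Finset.sum_le_sum fun j _ => ?_) (by linarith)
    refine mul_le_mul_of_nonneg_right ?_ (mul_nonneg (hτ j).le (hg j))
    exact Real.exp_le_exp.2 (neg_le_neg (mul_le_mul_of_nonneg_left
      (ht.strictMono.monotone (Fin.le_last _)) hK))

/-! ### From grid values to norms in time -/

theorem IsTimeGrid.Ioo_subset {T : ℝ} {N : ℕ} {t : Fin (N + 1) → ℝ} (ht : IsTimeGrid T N t) :
    Ioo 0 T ⊆ ⋃ j : Fin N, Ioc (t j.castSucc) (t j.succ) := by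
  have key : ∀ (i : Fin (N + 1)) (s : ℝ), t 0 < s → s ≤ t i →
      ∃ j : Fin N, s ∈ Ioc (t j.castSucc) (t j.succ) := by
    intro i s hs
    induction i using Fin.induction with
    | zero => intro h; exact absurd h (not_le.2 hs)
    | succ j ih =>
      intro h
      rcases le_or_gt s (t j.castSucc) with h' | h'
      · exact ih h'
      · exact ⟨j, h', h⟩
  intro s hs
  refine mem_iUnion.2 (key (Fin.last N) s ?_ ?_)
  · rw [ht.first]; exact hs.1
  · rw [ht.last]; exact hs.2.le

theorem eLpNorm_top_le_of_piecewise {X : Type*} [NormedAddCommGroup X] {T b : ℝ} {N : ℕ}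
    {t : Fin (N + 1) → ℝ} (ht : IsTimeGrid T N t) {v : ℝ → X} (hv : IsPiecewiseConst t v)
    (hb : ∀ j : Fin N, ‖v (t j.succ)‖ ≤ b) :
    eLpNorm v ∞ (volume.restrict (Ioo 0 T)) ≤ ENNReal.ofReal b := by
  rw [eLpNorm_exponent_top]
  refine eLpNormEssSup_le_of_ae_bound ?_
  filter_upwards [ae_restrict_mem measurableSet_Ioo] with s hs
  obtain ⟨j, hj⟩ := mem_iUnion.1 (ht.Ioo_subset hs)
  rw [hv j s hj]
  exact hb j

/-- Only an upper bound is needed, so covering the time interval and subadditivity of the integral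
suffice, without disjointness or measurability of `v`. -/
theorem eLpNorm_two_le_of_piecewise {X : Type*} [NormedAddCommGroup X] {T b : ℝ} {N : ℕ}
    {t : Fin (N + 1) → ℝ} (ht : IsTimeGrid T N t) {v : ℝ → X} (hv : IsPiecewiseConst t v)
    (hb : ∑ j : Fin N, stepSize t j * ‖v (t j.succ)‖ ^ 2 ≤ b) :
    eLpNorm v 2 (volume.restrict (Ioo 0 T)) ≤ ENNReal.ofReal (√b) := by
  have hτ : ∀ j : Fin N, 0 ≤ stepSize t j := fun j =>
    (sub_pos.2 (ht.strictMono (Fin.castSucc_lt_succ (i := j)))).le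
  have hb0 : 0 ≤ b := (Finset.sum_nonneg fun j _ => mul_nonneg (hτ j) (sq_nonneg _)).trans hb
  have h1 : ∫⁻ s in Ioo 0 T, ‖v s‖ₑ ^ (2 : ℝ) ≤ ENNReal.ofReal b := by
    calc ∫⁻ s in Ioo 0 T, ‖v s‖ₑ ^ (2 : ℝ)
        ≤ ∫⁻ s in ⋃ j : Fin N, Ioc (t j.castSucc) (t j.succ), ‖v s‖ₑ ^ (2 : ℝ) :=
          lintegral_mono_set ht.Ioo_subset
      _ ≤ ∑' j : Fin N, ∫⁻ s in Ioc (t j.castSucc) (t j.succ), ‖v s‖ₑ ^ (2 : ℝ) :=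
          lintegral_iUnion_le _ _
      _ = ∑ j : Fin N, ENNReal.ofReal (stepSize t j * ‖v (t j.succ)‖ ^ 2) := by
          rw [tsum_fintype]
          refine Finset.sum_congr rfl fun j _ => ?_
          rw [setLIntegral_congr_fun (g := fun _ => ‖v (t j.succ)‖ₑ ^ (2 : ℝ)) measurableSet_Ioc
            (fun s hs => by simp only [hv j s hs]), setLIntegral_const, Real.volume_Ioc, mul_comm,
            ENNReal.ofReal_mul (hτ j), ENNReal.ofReal_pow (norm_nonneg _), ofReal_norm,
            ENNReal.rpow_ofNat, stepSize]
      _ = ENNReal.ofReal (∑ j : Fin N, stepSize t j * ‖v (t j.succ)‖ ^ 2) :=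
          (ENNReal.ofReal_sum_of_nonneg fun j _ => mul_nonneg (hτ j) (sq_nonneg _)).symm
      _ ≤ ENNReal.ofReal b := ENNReal.ofReal_le_ofReal hb
  rw [eLpNorm_eq_lintegral_rpow_enorm_toReal (by simp) (by simp), ENNReal.toReal_ofNat,
    Real.sqrt_eq_rpow, ← ENNReal.ofReal_rpow_of_nonneg hb0 (by norm_num)]
  exact ENNReal.rpow_le_rpow h1 (by norm_num)

/-- The energy inequality for the difference of two discrete states. -/
theorem discreteState_step {d : ℕ} {Ω : Set (E d)} [IsFiniteMeasure (volume.restrict Ω)]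
    {T ε C_A Cψ c η : ℝ} (hε : 0 < ε) (hC_A : 0 < C_A) (hc : c < 1) {A B : E d → ℝ} {ψ : ℝ → ℝ}
    {y₀ : H1 Ω} (hA : AnisotropyAssumption A) (hψ : PotentialAssumption ψ Cψ)
    (hB : ContDiff ℝ 1 B) (hmono : StronglyMonotoneWith C_A (gradient B))
    (hAB : ∀ p, ‖gradient B p - gradient A p‖ ≤ η) {N : ℕ} {t : Fin (N + 1) → ℝ}
    (ht : IsTimeGrid T N t) {u : ℝ → L2 Ω} {y z : ℝ → H1 Ω}
    (hy : IsDiscreteState Ω ε A ψ t y₀ u y) (hz : IsDiscreteState Ω ε B ψ t y₀ u z)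
    (j : Fin N) (hstep : Cψ / ε ^ 2 * stepSize t j ≤ c) :
    ‖fn (y (t j.succ) - z (t j.succ))‖ ^ 2
        + stepSize t j * (C_A * ‖wgrad (y (t j.succ) - z (t j.succ))‖ ^ 2) ≤
      Real.exp (2 * (Cψ / ε ^ 2 / (1 - c)) * stepSize t j) *
        (‖fn (y (t j.castSucc) - z (t j.castSucc))‖ ^ 2
          + stepSize t j * (η ^ 2 / C_A * (volume.restrict Ω).real univ)) := by
  have hτ : 0 < stepSize t j := sub_pos.2 (ht.strictMono (Fin.castSucc_lt_succ (i := j)))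
  set e := y (t j.succ) - z (t j.succ) with he
  have hG := integral_inner_gradient_ge hA hB hC_A hmono hAB (y (t j.succ)) (z (t j.succ))
  have hP := integral_deriv_mul_ge hψ (hy.integrable j e) (hz.integrable j e)
  have h1 := hy.equation j e
  have h2 := hz.equation j e
  rw [← he] at hG
  refine step_estimate (s := inner ℝ (fn (y (t j.castSucc) - z (t j.castSucc))) (fn e))
    hε hτ hψ.nonneg hC_A (sq_nonneg _) (by positivity) hc hstep ?_ (le_trans (le_of_eq ?_) hG) hP ?_
  · rw [mul_comm]; exact real_inner_le_norm _ _
  · field_simp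
  · have e1 : ‖fn e‖ ^ 2 = inner ℝ (fn (y (t j.succ))) (fn e)
        - inner ℝ (fn (z (t j.succ))) (fn e) := by
      rw [← inner_sub_left, ← fn_sub, ← he, real_inner_self_eq_norm_sq]
    rw [e1, fn_sub (y (t j.castSucc)), inner_sub_left]
    linear_combination h1 - h2

end AllenCahn

theorem mainTheorem6 {d : ℕ} (Ω : Set (AllenCahn.E d)) (hΩ_open : IsOpen Ω)
    (hΩ_bdd : Bornology.IsBounded Ω)
    (T ε : ℝ) (hT : 0 < T) (hε : 0 < ε) (C_A Cψ c : ℝ) (hC_A : 0 < C_A) (hc : c < 1) :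
    ∃ C : ℝ, 0 < C ∧
      ∀ (A : AllenCahn.E d → ℝ) (ψ : ℝ → ℝ) (y₀ : AllenCahn.H1 Ω),
        AllenCahn.AnisotropyAssumption A →
        AllenCahn.PotentialAssumption ψ Cψ →
        IntegrableOn (fun x => ψ (AllenCahn.fn y₀ x)) Ω →
      ∀ (D : Set ℝ) (Aδ : ℝ → AllenCahn.E d → ℝ) (η : ℝ → ℝ),
        (∀ δ ∈ D, ContDiff ℝ 1 (Aδ δ)) →
        (∀ δ ∈ D, AllenCahn.StronglyMonotoneWith C_A (gradient (Aδ δ))) →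
        (∀ δ ∈ D, ∀ p, ‖gradient (Aδ δ) p - gradient A p‖ ≤ η δ) →
      ∀ (N : ℕ) (t : Fin (N + 1) → ℝ), AllenCahn.IsTimeGrid T N t →
        (∀ j : Fin N, Cψ / ε ^ 2 * AllenCahn.stepSize t j ≤ c) →
      ∀ u : ℝ → AllenCahn.L2 Ω, AllenCahn.IsPiecewiseConst t u →
      ∀ δ ∈ D, ∀ y yδ : ℝ → AllenCahn.H1 Ω,
        AllenCahn.IsDiscreteState Ω ε A ψ t y₀ u y →
        AllenCahn.IsDiscreteState Ω ε (Aδ δ) ψ t y₀ u yδ →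
        eLpNorm (fun s => AllenCahn.fn (y s) - AllenCahn.fn (yδ s)) ∞ (volume.restrict (Ioo 0 T))
          + eLpNorm (fun s => AllenCahn.wgrad (y s) - AllenCahn.wgrad (yδ s)) 2 (volume.restrict (Ioo 0 T))
        ≤ ENNReal.ofReal (C * η δ) := by

  have : IsFiniteMeasure (volume.restrict Ω) :=
    ⟨by rw [Measure.restrict_apply_univ]; exact hΩ_bdd.measure_lt_top⟩
  set m := (volume.restrict Ω).real univ
  set K := 2 * (Cψ / ε ^ 2 / (1 - c)) with hK
  set Q := Real.exp (K * T) * (T * (m / C_A)) with hQ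
  have hm : 0 ≤ m := measureReal_nonneg
  have hQ0 : 0 ≤ Q := by positivity
  -- The two roots bound the two norms; the 1 only ensures positivity, since `Q = 0` when `Ω` is a
  -- null set.
  refine ⟨√Q + √(Q / C_A) + 1, by positivity, ?_⟩
  intro A ψ y₀ hA hψ _ D Aδ η hAδ hmono hη N t ht hstep u _ δ hδ y z hy hz
  have hη0 : 0 ≤ η δ := (norm_nonneg _).trans (hη δ hδ 0)
  have hK0 : 0 ≤ K := by
    have := hψ.nonneg
    have : 0 < 1 - c := by linarith
    positivity
  obtain ⟨h1, h2⟩ := AllenCahn.discrete_gronwall ht hK0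
    (R := η δ ^ 2 / C_A * m) (by positivity)
    (a := fun i => ‖AllenCahn.fn (y (t i) - z (t i))‖ ^ 2)
    (g := fun j => C_A * ‖AllenCahn.wgrad (y (t j.succ) - z (t j.succ))‖ ^ 2)
    (fun _ => sq_nonneg _) (fun _ => by positivity)
    (by
      rw [ht.first, hy.initial, hz.initial, sub_self, show AllenCahn.fn (0 : AllenCahn.H1 Ω) = 0
        from rfl, norm_zero]
      norm_num)
    (fun j => AllenCahn.discreteState_step hε hC_A hc hA hψ (hAδ δ hδ) (hmono δ hδ) (hη δ hδ) ht
      hy hz j (hstep j))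
  have hR : Real.exp (K * T) * (T * (η δ ^ 2 / C_A * m)) = Q * η δ ^ 2 := by rw [hQ]; ring
  rw [hR] at h1 h2
  have hb1 := AllenCahn.eLpNorm_top_le_of_piecewise ht
    (v := fun s => AllenCahn.fn (y s) - AllenCahn.fn (z s)) (b := √Q * η δ)
    (fun j s hs => by
      simp only
      rw [hy.piecewise_const j s hs, hz.piecewise_const j s hs])
    (fun j => by
      have h := Real.le_sqrt_of_sq_le (h1 j.succ)
      rwa [Real.sqrt_mul hQ0, Real.sqrt_sq hη0] at h)
  have hb2 := AllenCahn.eLpNorm_two_le_of_piecewise ht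
    (v := fun s => AllenCahn.wgrad (y s) - AllenCahn.wgrad (z s)) (b := Q / C_A * η δ ^ 2)
    (fun j s hs => by
      simp only
      rw [hy.piecewise_const j s hs, hz.piecewise_const j s hs])
    (by
      rw [div_mul_eq_mul_div, le_div_iff₀ hC_A, Finset.sum_mul]
      refine le_trans (le_of_eq (Finset.sum_congr rfl fun j _ => ?_)) h2
      rw [AllenCahn.wgrad_sub]
      ring)
  rw [Real.sqrt_mul (by positivity), Real.sqrt_sq hη0] at hb2
  refine (add_le_add hb1 hb2).trans ?_
  rw [← ENNReal.ofReal_add (by positivity) (by positivity)]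
  exact ENNReal.ofReal_le_ofReal (by linarith)
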